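/- Let $G$ be a compact Hausdorff topological group with Haar measure $\mu$, normalized so that $\mu(G)=1$. Let $X=\operatorname{conj}(G)$ be the space of conjugacy classes of $G$ with the quotient topology, let $\pi\colon G\to X$ be the quotient map, and equip $X$ with the pushforward of $\mu$, that is, the functional $f\mapsto\int_G f\circ\pi\,d\mu$ on the space $C(X)$ of continuous functions $f\colon X\to\mathbf{C}$. Let $(x_1,x_2,x_3,\ldots)$ be a sequence in $X$. Then $(x_i)$ is $\mu$-equidistributed, meaning that for every $f\in C(X)$ we have \[ \lim_{n\to\infty}\frac1n\sum_{i=1}^n f(x_i)=\int_G f\circ\pi\,d\mu, \] if and only if for every nontrivial irreducible character $\chi$ of $G$ we have \[ \lim_{n\to\infty}\frac1n\sum_{i=1}^n\chi(x_i)=0. \] Here an irreducible character of $G$ is the trace $\chi$ of a continuous irreducible finite-dimensional complex representation of $G$, regarded as a function on $X$ (it is constant on conjugacy classes), and $\chi$ is nontrivial if it is not the constant function $1$, the character of the trivial one-dimensional representation. -/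

import Mathlib

open MeasureTheory Filter Topology

/-- The quotient topology on the space `conj(G)` of conjugacy classes of a topological group. -/
instance ConjClasses.instTopologicalSpace {G : Type*} [Group G] [TopologicalSpace G] :
    TopologicalSpace (ConjClasses G) :=
  inferInstanceAs (TopologicalSpace (Quotient (IsConj.setoid G)))

/-- The quotient map `π : G → conj(G)`, as a continuous map. -/
def conjClassesMk (G : Type*) [Group G] [TopologicalSpace G] : C(G, ConjClasses G) where
  toFun := ConjClasses.mk
  continuous_toFun := continuous_quotient_mk'

open scoped ComplexOrder in
/-- A positive normalized Radon measure on a compact (Hausdorff) space `X`: a continuous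
`ℂ`-linear functional on `C(X)` which is nonnegative on nonnegative functions and maps the
constant function `1` to `1`. (`0 ≤ z` for complex `z` means that `z` is real and nonnegative.) -/
structure NormalizedRadonMeasure (X : Type*) [TopologicalSpace X] where
  /-- the functional `f ↦ μ(f)` -/
  toCLM : C(X, ℂ) →L[ℂ] ℂ
  nonneg : ∀ f : C(X, ℂ), (∀ x, 0 ≤ f x) → 0 ≤ toCLM f
  map_one : toCLM 1 = 1

namespace NormalizedRadonMeasure

theorem integrable_of_isProbabilityMeasure {X : Type*} [TopologicalSpace X] [CompactSpace X]
    [MeasurableSpace X] [BorelSpace X] (μ : Measure X) [IsProbabilityMeasure μ] (f : C(X, ℂ)) :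
    Integrable (fun x => f x) μ :=
  Integrable.of_bound f.continuous.measurable.aestronglyMeasurable ‖f‖
    (Eventually.of_forall fun x => f.norm_coe_le_norm x)

open scoped ComplexOrder in
/-- The functional `f ↦ ∫ f dμ` attached to a Borel probability measure `μ` on a compact space. -/
noncomputable def ofMeasure {X : Type*} [TopologicalSpace X] [CompactSpace X]
    [MeasurableSpace X] [BorelSpace X] (μ : Measure X) [IsProbabilityMeasure μ] :
    NormalizedRadonMeasure X where
  toCLM := LinearMap.mkContinuous
    { toFun := fun f => ∫ x, f x ∂μ
      map_add' := fun f g => integral_add (integrable_of_isProbabilityMeasure μ f)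
        (integrable_of_isProbabilityMeasure μ g)
      map_smul' := fun c f => integral_const_mul c (fun x => f x) } 1
    (fun f => by
      have h := norm_integral_le_of_norm_le_const (μ := μ) (f := fun x => f x) (C := ‖f‖)
        (Eventually.of_forall fun x => f.norm_coe_le_norm x)
      simpa using h)
  nonneg := fun f hf => by
    have h : ∀ x, f x = (((f x).re : ℝ) : ℂ) := fun x => by
      have := (Complex.le_def.1 (hf x)).2
      apply Complex.ext <;> simp_all
    change 0 ≤ ∫ x, f x ∂μ
    rw [integral_congr_ae (Eventually.of_forall h), integral_complex_ofReal]
    exact Complex.zero_le_real.2 (integral_nonneg fun x => (Complex.le_def.1 (hf x)).1)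
  map_one := by
    change ∫ _, (1 : ℂ) ∂μ = 1
    simp

/-- The pushforward of a measure along a continuous map `p`, given by `f ↦ μ(f ∘ p)`. -/
noncomputable def map {X Y : Type*} [TopologicalSpace X] [TopologicalSpace Y]
    (p : C(X, Y)) (μ : NormalizedRadonMeasure X) : NormalizedRadonMeasure Y where
  toCLM :=
    { toFun := fun f => μ.toCLM (f.comp p)
      map_add' := fun f g => μ.toCLM.map_add (f.comp p) (g.comp p)
      map_smul' := fun c f => μ.toCLM.map_smul c (f.comp p)
      cont := μ.toCLM.continuous.comp (ContinuousMap.continuous_precomp p) }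
  nonneg := fun f hf => μ.nonneg (f.comp p) fun x => hf (p x)
  map_one := μ.map_one

/-- A sequence `x` in `X` is `μ`-equidistributed if for every `f ∈ C(X)` the averages of `f` over
the first `n` terms of the sequence converge to `μ(f)` (the terms are `x 0, x 1, x 2, …`). -/
def IsEquidistributed {X : Type*} [TopologicalSpace X] (μ : NormalizedRadonMeasure X)
    (x : ℕ → X) : Prop :=
  ∀ f : C(X, ℂ), Tendsto (fun n : ℕ => (1 / (n : ℂ)) * ∑ i ∈ Finset.range n, f (x i)) atTop
    (𝓝 (μ.toCLM f))

end NormalizedRadonMeasure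

/-- The pushforward to `conj(G)` of the normalized Haar measure `μ` of the compact group `G`. -/
noncomputable def haarConj {G : Type*} [Group G] [TopologicalSpace G] [CompactSpace G]
    [MeasurableSpace G] [BorelSpace G] (μ : Measure G) [IsProbabilityMeasure μ] :
    NormalizedRadonMeasure (ConjClasses G) :=
  (NormalizedRadonMeasure.ofMeasure μ).map (conjClassesMk G)

/-- `χ : conj(G) → ℂ` is an irreducible character of the topological group `G`: the class function
`g ↦ χ([g])` is the character (the trace) of a continuous irreducible finite-dimensional complex
representation of `G`. Choosing a basis, the space of the representation is taken to be `ℂᵈ`;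
since it is finite-dimensional, continuity of `ρ` means continuity of `g ↦ ρ g v` for all `v`. -/
def IsIrreducibleCharacter {G : Type*} [Group G] [TopologicalSpace G]
    (χ : ConjClasses G → ℂ) : Prop :=
  ∃ (d : ℕ) (ρ : Representation ℂ G (Fin d → ℂ)),
    (∀ v, Continuous fun g => ρ g v) ∧ ρ.IsIrreducible ∧
      ∀ g : G, χ (ConjClasses.mk g) = ρ.character g

/-!
The averaging functionals `f ↦ (1/n) ∑ f (x i)` on `C(conj G)` are contractions, so the set of
functions whose averages converge to the mean is a closed subspace. It contains the constants, and a
nontrivial irreducible character has mean zero, because the mean of an irreducible representation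
`ρ` has image in the invariant vectors of `ρ` (`IsIrreducibleCharacter.integral_eq_zero`). The
equivalence therefore amounts to the density of the span of the irreducible characters in
`C(conj G)` (`topologicalClosure_irreducibleCharacterSpan`), which is the Peter–Weyl theorem for
class functions.

Density is proved in two steps. Convolution with a symmetric continuous kernel is a compact
self-adjoint operator on `L²(G)` that commutes with left translation and takes values in `C(G)`. By
the spectral theorem its values are uniform limits of combinations of eigenfunctions with nonzero
eigenvalue, and these lie in finite-dimensional translation-invariant spaces of continuous
functions. An approximate identity then shows that such translation finite functions span a dense
subspace of `C(G)` (`topologicalClosure_span_translationFinite`). A translation finite function is,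
up to inversion, a matrix coefficient `g ↦ φ (ρ g v)`, and averaging it over conjugation gives
`g ↦ tr (ρ g ∘ B)` with `B` commuting with `ρ`. Such a function is a combination of irreducible
characters (`exists_mem_irreducibleCharacterSpan_trace_comp`), by induction on the dimension with
Schur's argument. Averaging over conjugation is a contraction fixing class functions, so the density
passes from `C(G)` to `C(conj G)`.

A Haar measure on `G` need not be regular here, while the density of `C(G)` in `L²(G)` requires
regularity. This is harmless, since the density statement does not mention the measure: its proof
uses the regular Haar measure `MeasureTheory.Measure.haarMeasure`.
-/

/-! ### Irreducible characters and commuting endomorphisms -/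

/-- Irreducibility in terms of invariant subspaces. -/
theorem Representation.isIrreducible_iff_forall_submodule {k G V : Type*} [Field k] [Monoid G]
    [AddCommGroup V] [Module k V] (ρ : Representation k G V) :
    ρ.IsIrreducible ↔
      Nontrivial V ∧ ∀ W : Submodule k V, (∀ g, W ≤ W.comap (ρ g)) → W = ⊥ ∨ W = ⊤ := by
  constructor
  · intro h
    refine ⟨?_, fun W hW => ?_⟩
    · by_contra hV
      rw [not_nontrivial_iff_subsingleton] at hV
      obtain ⟨a, b, hab⟩ := h.toNontrivial
      exact hab (Subrepresentation.toSubmodule_injective (Subsingleton.elim _ _))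
    · rcases h.eq_bot_or_eq_top ⟨W, fun g v hv => hW g hv⟩ with h | h
      · exact .inl (congrArg Subrepresentation.toSubmodule h)
      · exact .inr (congrArg Subrepresentation.toSubmodule h)
  · rintro ⟨hV, h⟩
    exact
      { exists_pair_ne := ⟨⊥, ⊤, fun e =>
          bot_ne_top (α := Submodule k V) (congrArg Subrepresentation.toSubmodule e)⟩
        eq_bot_or_eq_top := fun W => by
          rcases h W.toSubmodule (fun g v hv => W.apply_mem_toSubmodule g hv) with h | h
          · exact .inl (Subrepresentation.toSubmodule_injective h)
          · exact .inr (Subrepresentation.toSubmodule_injective h) }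

/-- The trace is additive along an invariant subspace and its quotient. -/
theorem LinearMap.trace_restrict_add_trace_mapQ {k V : Type*} [Field k] [AddCommGroup V]
    [Module k V] [FiniteDimensional k V] (A : V →ₗ[k] V) (W : Submodule k V)
    (hA : W ≤ W.comap A) :
    LinearMap.trace k W (A.restrict hA) + LinearMap.trace k (V ⧸ W) (W.mapQ W A hA) =
      LinearMap.trace k V A := by
  obtain ⟨p, hp⟩ := W.subtype.exists_leftInverse_of_injective W.ker_subtype
  have hp' : ∀ w : W, p w = w := fun w => LinearMap.congr_fun hp w
  -- `s` is the section of the quotient map with image the kernel of the retraction `p`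
  let s : (V ⧸ W) →ₗ[k] V := W.liftQ (LinearMap.id - W.subtype ∘ₗ p) fun w hw => by
    simp [hp' ⟨w, hw⟩]
  have hs : s ∘ₗ W.mkQ = LinearMap.id - W.subtype ∘ₗ p := W.liftQ_mkQ _ _
  have h1 : A.restrict hA = (p ∘ₗ A) ∘ₗ W.subtype := by
    ext w
    simpa using congrArg Subtype.val (hp' ⟨A w, hA w.2⟩).symm
  have h2 : W.mapQ W A hA = (W.mkQ ∘ₗ A) ∘ₗ s := by
    refine Submodule.linearMap_qext _ ?_
    rw [LinearMap.comp_assoc, hs]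
    ext v
    simpa [sub_eq_add_neg] using (Submodule.Quotient.mk_eq_zero W).2 (hA (p v).2)
  rw [h1, h2, LinearMap.trace_comp_comm', LinearMap.trace_comp_comm' s (W.mkQ ∘ₗ A),
    ← LinearMap.comp_assoc A W.mkQ s, hs, ← map_add]
  congr 1
  ext v
  simp

section Characters

variable {G : Type*} [Group G] [TopologicalSpace G]

/-- A representation has continuous matrix coefficients if every function `g ↦ φ (ρ g v)` is
continuous. For a finite-dimensional representation this is continuity in the usual sense,
expressed without choosing a topology on the space of the representation. -/
def HasContinuousCoefficients {V : Type*} [AddCommGroup V] [Module ℂ V]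
    (ρ : Representation ℂ G V) : Prop :=
  ∀ (v : V) (φ : V →ₗ[ℂ] ℂ), Continuous fun g => φ (ρ g v)

theorem HasContinuousCoefficients.subrepresentation {V : Type*} [AddCommGroup V] [Module ℂ V]
    {ρ : Representation ℂ G V} (hρ : HasContinuousCoefficients ρ) (W : Submodule ℂ V)
    (hW : ∀ g, W ≤ W.comap (ρ g)) : HasContinuousCoefficients (ρ.subrepresentation W hW) := by
  intro v φ
  obtain ⟨ψ, hψ⟩ := LinearMap.exists_extend φ
  refine (hρ v ψ).congr fun g => ?_
  rw [← hψ]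
  rfl

theorem HasContinuousCoefficients.quotient {V : Type*} [AddCommGroup V] [Module ℂ V]
    {ρ : Representation ℂ G V} (hρ : HasContinuousCoefficients ρ) (W : Submodule ℂ V)
    (hW : ∀ g, W ≤ W.comap (ρ g)) : HasContinuousCoefficients (ρ.quotient W hW) := by
  intro v φ
  obtain ⟨v, rfl⟩ := W.mkQ_surjective v
  exact hρ v (φ ∘ₗ W.mkQ)

theorem IsIrreducibleCharacter.continuous {χ : ConjClasses G → ℂ}
    (hχ : IsIrreducibleCharacter χ) : Continuous χ := by
  obtain ⟨d, ρ, hρ, -, h⟩ := hχ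
  refine (isQuotientMap_quotient_mk' (s := IsConj.setoid G)).continuous_iff.2 ?_
  refine Continuous.congr (f := fun g => ρ.character g) ?_ fun g => (h g).symm
  simp_rw [Representation.character, LinearMap.trace_eq_matrix_trace ℂ (Pi.basisFun ℂ (Fin d)),
    Matrix.trace, Matrix.diag, LinearMap.toMatrix_apply]
  exact continuous_finsetSum _ fun i _ => (continuous_apply i).comp (hρ _)

variable (G) in
/-- The space of class functions spanned by the irreducible characters of `G`. -/
noncomputable def irreducibleCharacterSpan : Submodule ℂ C(ConjClasses G, ℂ) :=
  Submodule.span ℂ {χ | IsIrreducibleCharacter χ}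

theorem exists_character_eq_of_isIrreducible {V : Type*} [AddCommGroup V] [Module ℂ V]
    [FiniteDimensional ℂ V] {ρ : Representation ℂ G V} (hρ : HasContinuousCoefficients ρ)
    (hirr : ρ.IsIrreducible) :
    ∃ χ ∈ irreducibleCharacterSpan G, ∀ g, χ (ConjClasses.mk g) = ρ.character g := by
  let e : V ≃ₗ[ℂ] (Fin (Module.finrank ℂ V) → ℂ) := (Module.finBasis ℂ V).equivFun
  let σ : Representation ℂ G (Fin (Module.finrank ℂ V) → ℂ) :=
    (e.conjAlgEquiv ℂ : Module.End ℂ V →* _).comp ρ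
  have hσ : ∀ g v, σ g v = e (ρ g (e.symm v)) := fun g v => rfl
  have hchar : ∀ g, σ.character g = ρ.character g := fun g => LinearMap.trace_conj' (ρ g) e
  let χ : ConjClasses G → ℂ := Quot.lift σ.character fun a b hab => by
    obtain ⟨c, rfl⟩ := isConj_iff.1 hab
    exact (σ.char_conj a c).symm
  have hχ : IsIrreducibleCharacter χ := by
    refine ⟨_, σ, fun v => ?_, ?_, fun g => rfl⟩
    · exact continuous_pi fun i => hρ (e.symm v) (LinearMap.proj i ∘ₗ e.toLinearMap)
    · rw [Representation.isIrreducible_iff_forall_submodule] at hirr ⊢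
      obtain ⟨hV, h⟩ := hirr
      refine ⟨e.symm.toEquiv.nontrivial, fun W hW => ?_⟩
      have := h (W.comap e.toLinearMap) fun g v hv => by
        simpa [hσ] using hW g (show e v ∈ W from hv)
      have hmap : (W.comap e.toLinearMap).map e.toLinearMap = W :=
        Submodule.map_comap_eq_of_surjective e.surjective W
      rcases this with h | h
      · left; rw [← hmap, h, Submodule.map_bot]
      · right; rw [← hmap, h, Submodule.map_top, LinearEquiv.range]
  exact ⟨⟨χ, hχ.continuous⟩, Submodule.subset_span hχ, hchar⟩

/-- If `B` commutes with a finite-dimensional representation `ρ`, the class function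
`g ↦ tr (ρ g ∘ B)` is a combination of irreducible characters. By induction on the dimension: a
proper subspace invariant under both `ρ` and `B` splits the trace; if there is none, then `B` is a
scalar, because its eigenspaces are invariant, and `ρ` is irreducible. -/
theorem exists_mem_irreducibleCharacterSpan_trace_comp (n : ℕ) :
    ∀ {V : Type*} [AddCommGroup V] [Module ℂ V] [FiniteDimensional ℂ V]
      {ρ : Representation ℂ G V} (_ : HasContinuousCoefficients ρ)
      (B : V →ₗ[ℂ] V) (_ : ∀ g v, B (ρ g v) = ρ g (B v)) (_ : Module.finrank ℂ V = n),
      ∃ F ∈ irreducibleCharacterSpan G, ∀ g,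
        F (ConjClasses.mk g) = LinearMap.trace ℂ V (ρ g ∘ₗ B) := by
  induction n using Nat.strong_induction_on with
  | _ n ih =>
    intro V _ _ _ ρ hρ B hB hn
    have split : ∀ W : Submodule ℂ V, W ≠ ⊥ → W ≠ ⊤ → (∀ g, W ≤ W.comap (ρ g)) →
        W ≤ W.comap B → ∃ F ∈ irreducibleCharacterSpan G, ∀ g,
        F (ConjClasses.mk g) = LinearMap.trace ℂ V (ρ g ∘ₗ B) := by
      intro W hbot htop hW hWB
      have hlt : Module.finrank ℂ W < n := hn ▸ Submodule.finrank_lt htop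
      have hlt' : Module.finrank ℂ (V ⧸ W) < n := by
        have h1 := W.finrank_quotient_add_finrank
        have h2 : 0 < Module.finrank ℂ W :=
          Nat.pos_of_ne_zero fun h => hbot (Submodule.finrank_eq_zero.1 h)
        omega
      obtain ⟨F₁, hF₁, h₁⟩ := ih _ hlt (hρ.subrepresentation W hW) (B.restrict hWB)
        (fun g v => Subtype.ext (hB g v)) rfl
      obtain ⟨F₂, hF₂, h₂⟩ := ih _ hlt' (hρ.quotient W hW) (W.mapQ W B hWB)
        (fun g v => by
          obtain ⟨v, rfl⟩ := W.mkQ_surjective v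
          exact congrArg W.mkQ (hB g v)) rfl
      refine ⟨F₁ + F₂, add_mem hF₁ hF₂, fun g => ?_⟩
      rw [ContinuousMap.add_apply, h₁, h₂,
        ← LinearMap.trace_restrict_add_trace_mapQ (ρ g ∘ₗ B) W fun v hv => hW g (hWB hv)]
      congr 2
      refine Submodule.linearMap_qext _ ?_
      ext v
      rfl
    rcases subsingleton_or_nontrivial V with hV | hV
    · refine ⟨0, zero_mem _, fun g => ?_⟩
      rw [Subsingleton.elim (ρ g ∘ₗ B) 0, map_zero, ContinuousMap.zero_apply]
    obtain ⟨c, hc⟩ := Module.End.exists_eigenvalue B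
    by_cases hE : Module.End.eigenspace B c = ⊤
    · have hBc : B = c • LinearMap.id := by
        ext v
        simpa using Module.End.mem_eigenspace_iff.1 (hE ▸ Submodule.mem_top : v ∈ _)
      by_cases hirr : ρ.IsIrreducible
      · obtain ⟨χ, hχ, h⟩ := exists_character_eq_of_isIrreducible hρ hirr
        refine ⟨c • χ, Submodule.smul_mem _ _ hχ, fun g => ?_⟩
        rw [ContinuousMap.smul_apply, h, hBc, LinearMap.comp_smul, map_smul, LinearMap.comp_id]
        rfl
      · rw [Representation.isIrreducible_iff_forall_submodule] at hirr
        push Not at hirr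
        obtain ⟨W, hW, h⟩ := hirr hV
        exact split W h.1 h.2 hW fun v hv => by
          simpa [hBc] using W.smul_mem c hv
    · refine split _ hc hE (fun g v hv => ?_) fun v hv => ?_
      · rw [Submodule.mem_comap, Module.End.mem_eigenspace_iff, hB,
          Module.End.mem_eigenspace_iff.1 hv, map_smul]
      · rw [Submodule.mem_comap, Module.End.mem_eigenspace_iff, ← map_smul,
          Module.End.mem_eigenspace_iff.1 hv]

end Characters

/-! ### Averaging over conjugation -/

section Averaging

variable {G : Type*} [Group G] [TopologicalSpace G] [IsTopologicalGroup G] [CompactSpace G]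
  [MeasurableSpace G] [BorelSpace G]

theorem Continuous.integrable_of_compactSpace {X : Type*} [TopologicalSpace X] [CompactSpace X]
    [MeasurableSpace X] [BorelSpace X] {μ : Measure X} [IsFiniteMeasure μ] {f : X → ℂ}
    (hf : Continuous f) : Integrable f μ :=
  hf.integrable_of_hasCompactSupport (HasCompactSupport.of_compactSpace f)

/-- The weak integral of a weakly continuous family of endomorphisms of a finite-dimensional
space. -/
theorem exists_weak_integral {X V : Type*} [TopologicalSpace X] [CompactSpace X]
    [MeasurableSpace X] [BorelSpace X] (μ : Measure X) [IsFiniteMeasure μ]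
    [AddCommGroup V] [Module ℂ V] [FiniteDimensional ℂ V] (f : X → V →ₗ[ℂ] V)
    (hf : ∀ (u : V) (ψ : V →ₗ[ℂ] ℂ), Continuous fun t => ψ (f t u)) :
    ∃ B : V →ₗ[ℂ] V, ∀ (u : V) (ψ : V →ₗ[ℂ] ℂ), ψ (B u) = ∫ t, ψ (f t u) ∂μ := by
  let b := Module.finBasis ℂ V
  have hint : ∀ (u : V) (ψ : V →ₗ[ℂ] ℂ), Integrable (fun t => ψ (f t u)) μ :=
    fun u ψ => (hf u ψ).integrable_of_compactSpace
  refine ⟨{ toFun := fun u => ∑ i, (∫ t, b.coord i (f t u) ∂μ) • b i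
            map_add' := fun u v => ?_
            map_smul' := fun c u => ?_ }, fun u ψ => ?_⟩
  · simp only [map_add, integral_add (hint _ _) (hint _ _), add_smul, Finset.sum_add_distrib]
  · simp only [map_smul, smul_eq_mul, integral_const_mul, mul_smul, Finset.smul_sum,
      RingHom.id_apply]
  · have h : ∀ t, ψ (f t u) = ∑ i, b.coord i (f t u) * ψ (b i) := fun t => by
      conv_lhs => rw [← b.sum_repr (f t u), map_sum]
      exact Finset.sum_congr rfl fun i _ => map_smul ψ _ _
    simp_rw [h]
    rw [integral_finsetSum _ fun i _ => (hint _ _).mul_const _]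
    simp [integral_mul_const]

/-- Averaging a matrix coefficient `g ↦ φ (ρ g v)` over conjugation gives a combination of
irreducible characters: the average is `g ↦ tr (ρ g ∘ B)`, where `B`, the mean of
`ρ t ∘ (v ⊗ φ) ∘ ρ t⁻¹`, commutes with `ρ`. -/
theorem exists_mem_irreducibleCharacterSpan_average (μ : Measure G) [IsFiniteMeasure μ]
    [μ.IsMulLeftInvariant] {V : Type*} [AddCommGroup V] [Module ℂ V] [FiniteDimensional ℂ V]
    {ρ : Representation ℂ G V} (hρ : HasContinuousCoefficients ρ) (v : V) (φ : V →ₗ[ℂ] ℂ) :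
    ∃ F ∈ irreducibleCharacterSpan G, ∀ g,
      F (ConjClasses.mk g) = ∫ t, φ (ρ (t⁻¹ * g * t) v) ∂μ := by
  let f : G → V →ₗ[ℂ] V := fun t => ρ t ∘ₗ φ.smulRight v ∘ₗ ρ t⁻¹
  have hfapp : ∀ t u (ψ : V →ₗ[ℂ] ℂ), ψ (f t u) = φ (ρ t⁻¹ u) * ψ (ρ t v) := fun t u ψ => by
    simp [f]
  obtain ⟨B, hB⟩ := exists_weak_integral μ f fun u ψ => by
    simp_rw [hfapp]
    exact ((hρ u φ).comp continuous_inv).mul (hρ v ψ)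
  have hcomm : ∀ g u, B (ρ g u) = ρ g (B u) := by
    intro s u
    refine (Module.forall_dual_apply_eq_zero_iff ℂ _).1 ?_ |> sub_eq_zero.1
    intro ψ
    rw [map_sub, sub_eq_zero, hB, ← LinearMap.comp_apply ψ, hB,
      ← integral_mul_left_eq_self (fun t => ψ (f t (ρ s u))) s]
    refine integral_congr_ae (.of_forall fun t => ?_)
    simp [hfapp, mul_inv_rev]
  obtain ⟨F, hF, h⟩ := exists_mem_irreducibleCharacterSpan_trace_comp _ hρ B hcomm rfl
  refine ⟨F, hF, fun g => ?_⟩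
  let b := Module.finBasis ℂ V
  have htr : ∀ A : V →ₗ[ℂ] V, LinearMap.trace ℂ V A = ∑ i, b.coord i (A (b i)) := fun A => by
    simp [LinearMap.trace_eq_matrix_trace ℂ b, Matrix.trace, LinearMap.toMatrix_apply]
  have hint : ∀ i, Integrable (fun t => (b.coord i ∘ₗ ρ g) (f t (b i))) μ := fun i => by
    simp_rw [hfapp]
    exact (((hρ _ φ).comp continuous_inv).mul (hρ v _)).integrable_of_compactSpace
  have hmean : ∀ i, b.coord i ((ρ g ∘ₗ B) (b i)) = ∫ t, (b.coord i ∘ₗ ρ g) (f t (b i)) ∂μ :=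
    fun i => hB (b i) (b.coord i ∘ₗ ρ g)
  rw [h, htr]
  simp_rw [hmean]
  rw [← integral_finsetSum _ fun i _ => hint i]
  refine integral_congr_ae (.of_forall fun t => ?_)
  have hconj : (ρ g ∘ₗ ρ t ∘ₗ φ.smulRight v) ∘ₗ ρ t⁻¹ = ρ g ∘ₗ f t := rfl
  calc ∑ i, (b.coord i ∘ₗ ρ g) (f t (b i)) = LinearMap.trace ℂ V (ρ g ∘ₗ f t) := by
        rw [htr]; rfl
    _ = LinearMap.trace ℂ V (φ.smulRight (ρ (t⁻¹ * g * t) v)) := by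
        rw [← hconj, LinearMap.trace_comp_comm']
        congr 1
        ext u
        simp
    _ = φ (ρ (t⁻¹ * g * t) v) := LinearMap.trace_smulRight φ _

end Averaging

/-! ### Translation finite functions are dense -/

section CompactOperator

variable {X H : Type*} [TopologicalSpace X] [CompactSpace X] [NormedAddCommGroup H]
  [InnerProductSpace ℂ H]

/-- The operator `H → C(X)` with kernel `k : X → H`, sending `v` to `x ↦ ⟪k x, v⟫`. -/
noncomputable def innerKernelOp (k : C(X, H)) : H →L[ℂ] C(X, ℂ) :=
  LinearMap.mkContinuous
    { toFun := fun v => ⟨fun x => inner ℂ (k x) v, by fun_prop⟩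
      map_add' := fun v w => by ext x; exact inner_add_right _ _ _
      map_smul' := fun c v => by ext x; exact inner_smul_right _ _ _ } ‖k‖
    fun v => (ContinuousMap.norm_le _ (by positivity)).2 fun x =>
      (norm_inner_le_norm _ _).trans (by gcongr; exact k.norm_coe_le_norm x)

theorem innerKernelOp_apply (k : C(X, H)) (v : H) (x : X) :
    innerKernelOp k v x = inner ℂ (k x) v := rfl

theorem isCompactOperator_innerKernelOp (k : C(X, H)) : IsCompactOperator (innerKernelOp k) := by
  let e := ContinuousMap.isometryEquivBoundedOfCompact X ℂ
  let A : Set (BoundedContinuousFunction X ℂ) :=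
    (fun v => e (innerKernelOp k v)) '' Metric.closedBall 0 1
  have hA : IsCompact (closure A) := by
    refine BoundedContinuousFunction.arzela_ascoli (Metric.closedBall 0 ‖k‖)
      (isCompact_closedBall _ _) A ?_ ?_
    · rintro _ x ⟨v, hv, rfl⟩
      rw [mem_closedBall_zero_iff] at hv ⊢
      calc ‖inner ℂ (k x) v‖ ≤ ‖k x‖ * ‖v‖ := norm_inner_le_norm _ _
        _ ≤ ‖k‖ * 1 := by gcongr; exact k.norm_coe_le_norm x
        _ = ‖k‖ := mul_one _
    · intro x
      refine Metric.equicontinuousAt_of_continuity_modulus (fun y => ‖k x - k y‖) ?_ _ ?_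
      · have : Continuous fun y => ‖k x - k y‖ := by fun_prop
        simpa using this.tendsto x
      · refine .of_forall ?_
        rintro y ⟨_, v, hv, rfl⟩
        rw [mem_closedBall_zero_iff] at hv
        change dist (inner ℂ (k x) v) (inner ℂ (k y) v) ≤ _
        rw [dist_eq_norm, ← inner_sub_left]
        calc ‖inner ℂ (k x - k y) v‖ ≤ ‖k x - k y‖ * ‖v‖ := norm_inner_le_norm _ _
          _ ≤ ‖k x - k y‖ * 1 := by gcongr
          _ = _ := mul_one _
  refine ⟨e.symm '' closure A, hA.image e.symm.continuous,
    mem_of_superset (Metric.closedBall_mem_nhds 0 one_pos) fun v hv => ?_⟩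
  exact ⟨_, subset_closure ⟨v, hv, rfl⟩, e.symm_apply_apply _⟩

end CompactOperator

section TranslationFinite

variable {G : Type*} [Group G] [TopologicalSpace G] [IsTopologicalGroup G]

variable (G) in
/-- The left translation action `(g • u) x = u (g⁻¹ * x)` of a topological group on its continuous
functions. -/
noncomputable def leftTranslation : Representation ℂ G C(G, ℂ) where
  toFun g :=
    { toFun := fun u => ⟨fun x => u (g⁻¹ * x), by fun_prop⟩
      map_add' := fun _ _ => rfl
      map_smul' := fun _ _ => rfl }
  map_one' := by ext; simp
  map_mul' g h := by ext; simp [mul_assoc]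

@[simp]
theorem leftTranslation_apply (g : G) (u : C(G, ℂ)) (x : G) :
    leftTranslation G g u x = u (g⁻¹ * x) := rfl

theorem continuous_leftTranslation (u : C(G, ℂ)) : Continuous fun g => leftTranslation G g u :=
  (ContinuousMap.curry ⟨fun p : G × G => u (p.1⁻¹ * p.2), by fun_prop⟩).continuous

variable (G) in
/-- The continuous functions lying in a finite-dimensional subspace of `C(G)` that is invariant
under left translation. -/
def translationFinite : Set C(G, ℂ) :=
  {u | ∃ W : Submodule ℂ C(G, ℂ), FiniteDimensional ℂ W ∧
    (∀ g, W ≤ W.comap (leftTranslation G g)) ∧ u ∈ W}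

/-- A translation finite function `u` is a matrix coefficient up to inversion, since
`u g⁻¹ = (g • u) 1`. Hence its averages over conjugation are combinations of characters. -/
theorem exists_average_of_mem_translationFinite [CompactSpace G] [MeasurableSpace G] [BorelSpace G]
    (μ : Measure G) [IsFiniteMeasure μ] [μ.IsMulLeftInvariant] {u : C(G, ℂ)}
    (hu : u ∈ translationFinite G) :
    ∃ F ∈ irreducibleCharacterSpan G, ∀ g,
      F (ConjClasses.mk g) = ∫ t, u (t⁻¹ * g * t)⁻¹ ∂μ := by
  obtain ⟨W, hfin, hW, hu⟩ := hu
  have hcont : HasContinuousCoefficients ((leftTranslation G).subrepresentation W hW) :=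
    fun v φ => φ.continuous_of_finiteDimensional.comp
      ((continuous_leftTranslation (v : C(G, ℂ))).subtype_mk fun g => hW g v.2)
  obtain ⟨F, hF, h⟩ := exists_mem_irreducibleCharacterSpan_average μ hcont ⟨u, hu⟩
    ((ContinuousMap.evalCLM ℂ (1 : G)).toLinearMap ∘ₗ W.subtype)
  refine ⟨F, hF, fun g => (h g).trans (integral_congr_ae (.of_forall fun t => ?_))⟩
  change u ((t⁻¹ * g * t)⁻¹ * 1) = _
  rw [mul_one]

end TranslationFinite

section Convolution

variable {G : Type*} [Group G] [TopologicalSpace G] [IsTopologicalGroup G] [CompactSpace G]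
  [MeasurableSpace G] [BorelSpace G]

/-- The operator `f ↦ (x ↦ ∫ K (x⁻¹ * y) f y dμ(y))` from `L²(G)` to `C(G)`. -/
noncomputable def convolutionOp (μ : Measure G) [IsFiniteMeasure μ] (K : C(G, ℝ)) :
    Lp ℂ 2 μ →L[ℂ] C(G, ℂ) :=
  innerKernelOp (ContinuousMap.comp ⟨ContinuousMap.toLp 2 μ ℂ, ContinuousLinearMap.continuous _⟩
    (ContinuousMap.curry ⟨fun p : G × G => (K (p.1⁻¹ * p.2) : ℂ), by fun_prop⟩))

variable {μ : Measure G} [IsFiniteMeasure μ] (K : C(G, ℝ))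

theorem convolutionOp_toLp_apply (f : C(G, ℂ)) (x : G) :
    convolutionOp μ K (ContinuousMap.toLp 2 μ ℂ f) x = ∫ y, f y * K (x⁻¹ * y) ∂μ := by
  refine (ContinuousMap.inner_toLp μ _ f).trans (integral_congr_ae (.of_forall fun y => ?_))
  simp

theorem convolutionOp_leftTranslation [μ.IsMulLeftInvariant] (g : G) (f : C(G, ℂ)) :
    convolutionOp μ K (ContinuousMap.toLp 2 μ ℂ (leftTranslation G g f)) =
      leftTranslation G g (convolutionOp μ K (ContinuousMap.toLp 2 μ ℂ f)) := by
  ext x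
  rw [leftTranslation_apply, convolutionOp_toLp_apply, convolutionOp_toLp_apply,
    ← integral_mul_left_eq_self _ g]
  simp [mul_assoc]

theorem isSymmetric_toLp_comp_convolutionOp [T2Space G] [μ.WeaklyRegular]
    (hK : ∀ x, K x⁻¹ = K x) :
    ((ContinuousMap.toLp 2 μ ℂ).comp (convolutionOp μ K)).IsSymmetric := by
  have hd := ContinuousMap.toLp_denseRange (p := 2) ℂ μ ℂ (by simp)
  intro v w
  refine hd.induction_on₂ (p := fun v w =>
    inner ℂ (((ContinuousMap.toLp 2 μ ℂ).comp (convolutionOp μ K)) v) w =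
      inner ℂ v (((ContinuousMap.toLp 2 μ ℂ).comp (convolutionOp μ K)) w)) ?_ ?_ v w
  · exact isClosed_eq (by fun_prop) (by fun_prop)
  · intro f g
    simp only [ContinuousLinearMap.comp_apply]
    rw [ContinuousMap.inner_toLp, ContinuousMap.inner_toLp]
    simp_rw [convolutionOp_toLp_apply, ← integral_conj, ← integral_const_mul,
      ← integral_mul_const]
    rw [integral_integral_swap_of_hasCompactSupport
      (by unfold Function.uncurry; fun_prop) (HasCompactSupport.of_compactSpace _)]
    refine integral_congr_ae (.of_forall fun y => integral_congr_ae (.of_forall fun x => ?_))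
    have : K (x⁻¹ * y) = K (y⁻¹ * x) := by rw [← hK]; simp
    simp [this]
    ring

/-- Convolutions with a symmetric kernel are uniform limits of combinations of translation finite
functions: the compact self-adjoint operator on `L²(G)` given by the convolution has
finite-dimensional translation-invariant eigenspaces for nonzero eigenvalues, and these consist of
continuous functions. -/
theorem convolutionOp_mem_topologicalClosure [T2Space G] [μ.IsHaarMeasure] [μ.WeaklyRegular]
    (hK : ∀ x, K x⁻¹ = K x) (v : Lp ℂ 2 μ) :
    convolutionOp μ K v ∈ (Submodule.span ℂ (translationFinite G)).topologicalClosure := by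
  set T := convolutionOp μ K with hT
  let J : C(G, ℂ) →L[ℂ] Lp ℂ 2 μ := ContinuousMap.toLp 2 μ ℂ
  have hcomp : IsCompactOperator (J.comp T) := (isCompactOperator_innerKernelOp _).clm_comp J
  have hdense := ContinuousLinearMap.orthogonalComplement_iSup_eigenspaces_eq_bot hcomp
    (isSymmetric_toLp_comp_convolutionOp K hK)
  rw [← Submodule.topologicalClosure_eq_top_iff] at hdense
  let S := (Submodule.span ℂ (translationFinite G)).topologicalClosure.comap T.toLinearMap
  have hS : IsClosed (S : Set (Lp ℂ 2 μ)) :=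
    (Submodule.isClosed_topologicalClosure _).preimage T.continuous
  suffices h : (⨆ c, Module.End.eigenspace (J.comp T).toLinearMap c) ≤ S by
    have := Submodule.topologicalClosure_minimal _ h hS
    rw [hdense] at this
    exact this (Submodule.mem_top (x := v))
  refine iSup_le fun c => ?_
  rcases eq_or_ne c 0 with rfl | hc
  · intro w hw
    have h0 : J (T w) = 0 := by simpa using Module.End.mem_eigenspace_iff.1 hw
    have : T w = 0 := ContinuousMap.toLp_injective μ (p := 2) (𝕜 := ℂ) (h0.trans (map_zero _).symm)
    exact Submodule.mem_comap.2 (this ▸ zero_mem _ : T w ∈ _)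
  · intro w hw
    refine Submodule.le_topologicalClosure _ (Submodule.subset_span ?_)
    have := ContinuousLinearMap.finite_dimensional_eigenspace hcomp c hc
    refine ⟨(Module.End.eigenspace (J.comp T).toLinearMap c).map T.toLinearMap, inferInstance,
      ?_, ⟨w, hw, rfl⟩⟩
    rintro g _ ⟨w, hw, rfl⟩
    have hw : J (T w) = c • w := Module.End.mem_eigenspace_iff.1 hw
    -- the eigenvector `w` is represented by the continuous function `c⁻¹ • T w`
    have hTJ : T (J (leftTranslation G g (T w))) = c • leftTranslation G g (T w) := by
      rw [hT, convolutionOp_leftTranslation, ← hT]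
      change leftTranslation G g (T (J (T w))) = _
      rw [hw, map_smul, map_smul]
    refine ⟨c⁻¹ • J (leftTranslation G g (T w)), ?_, ?_⟩
    · refine Module.End.mem_eigenspace_iff.2 ?_
      change J (T (c⁻¹ • J (leftTranslation G g (T w)))) = _
      rw [map_smul, hTJ, inv_smul_smul₀ hc, smul_inv_smul₀ hc]
    · change T (c⁻¹ • J (leftTranslation G g (T w))) = leftTranslation G g (T w)
      rw [map_smul, hTJ, inv_smul_smul₀ hc]

/-- Symmetric approximate identities. -/
theorem exists_norm_convolutionOp_sub_le [T2Space G] [μ.IsHaarMeasure] (f : C(G, ℂ)) {ε : ℝ}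
    (hε : 0 < ε) :
    ∃ K : C(G, ℝ), (∀ x, K x⁻¹ = K x) ∧
      ‖convolutionOp μ K (ContinuousMap.toLp 2 μ ℂ f) - f‖ ≤ ε := by
  -- `f` is uniformly continuous
  let R : C(G, C(G, ℂ)) := ContinuousMap.curry ⟨fun p : G × G => f (p.2 * p.1), by fun_prop⟩
  have hR : ∀ᶠ z in 𝓝 (1 : G), ∀ x, ‖f (x * z) - f x‖ ≤ ε := by
    filter_upwards [(R.continuous.tendsto 1).eventually (Metric.ball_mem_nhds _ hε)] with z hz x
    have := ((R z - R 1).norm_coe_le_norm x).trans (mem_ball_iff_norm.1 hz).le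
    simpa [R] using this
  obtain ⟨U, hU, hUo, h1U⟩ := eventually_nhds_iff.1 (hR.and (tendsto_inv (1 : G) |>.eventually
    (by simpa using hR)))
  obtain ⟨K₀, hK₀, hK₁, hK₀'⟩ := exists_continuous_zero_one_of_isClosed hUo.isClosed_compl
    (isClosed_singleton (x := (1 : G))) (by simpa using h1U)
  let K₁ : C(G, ℝ) := K₀ + K₀.comp ⟨Inv.inv, continuous_inv⟩
  have hK₁app : ∀ x, K₁ x = K₀ x + K₀ x⁻¹ := fun x => rfl
  have hK₁nonneg : ∀ x, 0 ≤ K₁ x := fun x => add_nonneg (hK₀' x).1 (hK₀' _).1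
  have hpos : 0 < ∫ x, K₁ x ∂μ := by
    refine K₁.continuous.integral_pos_of_hasCompactSupport_nonneg_nonzero
      (HasCompactSupport.of_compactSpace _) hK₁nonneg (x := 1) ?_
    have : K₀ 1 = 1 := hK₁ rfl
    rw [hK₁app, inv_one, this]
    norm_num
  set c := ∫ x, K₁ x ∂μ
  let K : C(G, ℝ) := c⁻¹ • K₁
  have hKapp : ∀ x, K x = c⁻¹ * K₁ x := fun x => rfl
  have hKnonneg : ∀ x, 0 ≤ K x := fun x => mul_nonneg (inv_nonneg.2 hpos.le) (hK₁nonneg x)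
  have hKU : ∀ z x, ‖f (x * z) - f x‖ * K z ≤ ε * K z := by
    intro z x
    by_cases hz : z ∈ U
    · gcongr
      exacts [hKnonneg z, (hU z hz).1 x]
    by_cases hz' : z⁻¹ ∈ U
    · gcongr
      exacts [hKnonneg z, by simpa using (hU _ hz').2 x]
    · have : K z = 0 := by
        rw [hKapp, hK₁app, show K₀ z = 0 from hK₀ hz, show K₀ z⁻¹ = 0 from hK₀ hz']
        simp
      simp [this]
  refine ⟨K, fun x => ?_, (ContinuousMap.norm_le _ hε.le).2 fun x => ?_⟩
  · rw [hKapp, hKapp, hK₁app, hK₁app, inv_inv, add_comm]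
  have hKint : ∫ y, K (x⁻¹ * y) ∂μ = 1 := by
    rw [integral_mul_left_eq_self (fun y => K y) x⁻¹]
    simp_rw [hKapp]
    rw [integral_const_mul, inv_mul_cancel₀ hpos.ne']
  have hfx : f x = ∫ y, f x * (K (x⁻¹ * y) : ℂ) ∂μ := by
    rw [integral_const_mul, integral_complex_ofReal, hKint]
    simp
  have hint : ∀ h : C(G, ℂ), Integrable (fun y => h y * (K (x⁻¹ * y) : ℂ)) μ := fun h =>
    Continuous.integrable_of_compactSpace (by fun_prop)
  have hKi : Integrable (fun y => ε * K (x⁻¹ * y)) μ :=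
    Continuous.integrable_of_hasCompactSupport (by fun_prop) (HasCompactSupport.of_compactSpace _)
  rw [ContinuousMap.sub_apply, convolutionOp_toLp_apply, hfx, ← integral_sub (hint f)
    (g := fun y => f x * (K (x⁻¹ * y) : ℂ)) (hint (ContinuousMap.const G (f x)))]
  calc _ ≤ ∫ y, ε * K (x⁻¹ * y) ∂μ := by
        refine norm_integral_le_of_norm_le hKi (.of_forall fun y => ?_)
        have := hKU (x⁻¹ * y) x
        rw [mul_inv_cancel_left] at this
        rw [← sub_mul, norm_mul, Complex.norm_real,
          Real.norm_of_nonneg (hKnonneg _)]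
        exact this
    _ = ε := by rw [integral_const_mul, hKint, mul_one]

end Convolution

/-- A form of the Peter–Weyl theorem: the translation finite functions span a uniformly dense
subspace of `C(G)`. -/
theorem topologicalClosure_span_translationFinite (G : Type*) [Group G] [TopologicalSpace G]
    [IsTopologicalGroup G] [CompactSpace G] [T2Space G] :
    (Submodule.span ℂ (translationFinite G)).topologicalClosure = ⊤ := by
  borelize G
  let μ : Measure G := Measure.haar
  refine Submodule.eq_top_iff'.2 fun f => ?_
  refine (Submodule.isClosed_topologicalClosure _).closure_subset (Metric.mem_closure_iff.2 ?_)
  intro ε hε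
  obtain ⟨K, hK, h⟩ := exists_norm_convolutionOp_sub_le (μ := μ) f (half_pos hε)
  refine ⟨_, convolutionOp_mem_topologicalClosure K hK (ContinuousMap.toLp 2 μ ℂ f), ?_⟩
  rw [dist_comm, dist_eq_norm]
  exact h.trans_lt (half_lt_self hε)

/-! ### Equidistribution -/

section Equidistribution

/-- The combinations of irreducible characters are uniformly dense in the continuous class
functions: approximate a class function by translation finite functions and average over
conjugation. -/
theorem topologicalClosure_irreducibleCharacterSpan (G : Type*) [Group G] [TopologicalSpace G]
    [IsTopologicalGroup G] [CompactSpace G] [T2Space G] :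
    (irreducibleCharacterSpan G).topologicalClosure = ⊤ := by
  borelize G
  have : CompactSpace (ConjClasses G) := Quotient.compactSpace
  let μ : Measure G := Measure.haarMeasure ⊤
  have : IsProbabilityMeasure μ := ⟨Measure.haarMeasure_self⟩
  refine Submodule.eq_top_iff'.2 fun f => ?_
  rw [← SetLike.mem_coe, Submodule.topologicalClosure_coe]
  refine Metric.mem_closure_iff.2 fun ε hε => ?_
  -- the inversion is the one in `exists_average_of_mem_translationFinite`
  let f' : C(G, ℂ) := (f.comp (conjClassesMk G)).comp ⟨Inv.inv, continuous_inv⟩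
  have hf' : f' ∈ (Submodule.span ℂ (translationFinite G)).topologicalClosure := by
    rw [topologicalClosure_span_translationFinite]
    exact Submodule.mem_top
  obtain ⟨h, hh, hfh⟩ := Metric.mem_closure_iff.1 hf' _ (half_pos hε)
  have hint : ∀ (u : C(G, ℂ)) (g : G), Integrable (fun t => u (t⁻¹ * g * t)⁻¹) μ := fun u g =>
    Continuous.integrable_of_compactSpace (by fun_prop)
  obtain ⟨F, hF, hFh⟩ : ∃ F ∈ irreducibleCharacterSpan G, ∀ g,
      F (ConjClasses.mk g) = ∫ t, h (t⁻¹ * g * t)⁻¹ ∂μ := by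
    clear hfh
    induction hh using Submodule.span_induction with
    | mem u hu => exact exists_average_of_mem_translationFinite μ hu
    | zero => exact ⟨0, zero_mem _, by simp⟩
    | add u v _ _ hu hv =>
      obtain ⟨F₁, hF₁, h₁⟩ := hu
      obtain ⟨F₂, hF₂, h₂⟩ := hv
      refine ⟨F₁ + F₂, add_mem hF₁ hF₂, fun g => ?_⟩
      simp only [ContinuousMap.add_apply, h₁, h₂]
      exact (integral_add (hint u g) (hint v g)).symm
    | smul c u _ hu =>
      obtain ⟨F, hF, h⟩ := hu
      refine ⟨c • F, Submodule.smul_mem _ _ hF, fun g => ?_⟩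
      simp only [ContinuousMap.smul_apply, h]
      exact (integral_smul c _).symm
  refine ⟨F, hF, lt_of_le_of_lt ?_ (half_lt_self hε)⟩
  refine (ContinuousMap.dist_le (half_pos hε).le).2 fun x => ?_
  obtain ⟨g, rfl⟩ := ConjClasses.mk_surjective x
  have hfg : f (ConjClasses.mk g) = ∫ t, f' (t⁻¹ * g * t)⁻¹ ∂μ := by
    have : ∀ t : G, f' (t⁻¹ * g * t)⁻¹ = f (ConjClasses.mk g) := fun t => by
      change f (ConjClasses.mk (t⁻¹ * g * t)⁻¹⁻¹) = _
      rw [inv_inv, (ConjClasses.mk_eq_mk_iff_isConj (b := g)).2 (isConj_iff.2 ⟨t, by group⟩)]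
    simp_rw [this]
    simp
  rw [dist_eq_norm, hfg, hFh, ← integral_sub (hint f' g) (hint h g)]
  have := norm_integral_le_of_norm_le_const (μ := μ) (C := ε / 2)
    (f := fun t => f' (t⁻¹ * g * t)⁻¹ - h (t⁻¹ * g * t)⁻¹) (.of_forall fun t => by
      rw [← dist_eq_norm]
      exact (ContinuousMap.dist_apply_le_dist _).trans hfh.le)
  simpa using this

/-- A nontrivial irreducible character has mean zero, since the mean of `ρ` maps into the space of
invariant vectors, which vanishes. -/
theorem IsIrreducibleCharacter.integral_eq_zero {G : Type*} [Group G] [TopologicalSpace G]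
    [IsTopologicalGroup G] [CompactSpace G] [MeasurableSpace G] [BorelSpace G] (μ : Measure G)
    [IsFiniteMeasure μ] [μ.IsMulLeftInvariant] {χ : ConjClasses G → ℂ}
    (hχ : IsIrreducibleCharacter χ) (h1 : χ ≠ 1) : ∫ g, χ (ConjClasses.mk g) ∂μ = 0 := by
  obtain ⟨d, ρ, hcont, hirr, hχ⟩ := hχ
  have hρ : HasContinuousCoefficients ρ := fun v φ =>
    φ.continuous_of_finiteDimensional.comp (hcont v)
  obtain ⟨B, hB⟩ := exists_weak_integral μ (fun g => ρ g) hρ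
  have hinv : ∀ g v, ρ g (B v) = B v := by
    intro s v
    refine (Module.forall_dual_apply_eq_zero_iff ℂ _).1 ?_ |> sub_eq_zero.1
    intro ψ
    rw [map_sub, sub_eq_zero, hB, ← LinearMap.comp_apply ψ, hB,
      ← integral_mul_left_eq_self (fun t => ψ (ρ t v)) s]
    simp
  rw [Representation.isIrreducible_iff_forall_submodule] at hirr
  obtain ⟨hV, hirr⟩ := hirr
  have hB0 : B = 0 := by
    rcases hirr ρ.invariants (fun g v hv => (congrArg (· ∈ ρ.invariants) (hv g)).mpr hv) with h | h
    · refine LinearMap.ext fun v => ?_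
      have : B v ∈ ρ.invariants := fun g => hinv g v
      rw [h, Submodule.mem_bot] at this
      rw [this, LinearMap.zero_apply]
    · -- the action is trivial, so `ρ` has dimension one and its character is `1`
      have htriv : ∀ g v, ρ g v = v := fun g v => (h ▸ Submodule.mem_top : v ∈ ρ.invariants) g
      have htriv' : ∀ g, ρ g = LinearMap.id := fun g => LinearMap.ext (htriv g)
      obtain ⟨v, hv⟩ := exists_ne (0 : Fin d → ℂ)
      have hspan : Submodule.span ℂ {v} = ⊤ :=
        (hirr _ fun g w hw => by simpa [htriv] using hw).resolve_left (by simpa using hv)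
      refine absurd (funext fun x => ?_) h1
      obtain ⟨g, rfl⟩ := ConjClasses.mk_surjective x
      have hfin : Module.finrank ℂ (Fin d → ℂ) = 1 := by
        rw [← finrank_top, ← hspan, finrank_span_singleton hv]
      rw [hχ, Representation.character, htriv', LinearMap.trace_id, hfin]
      simp
  simp_rw [hχ, Representation.character, LinearMap.trace_eq_matrix_trace ℂ (Pi.basisFun ℂ (Fin d)),
    Matrix.trace, Matrix.diag, LinearMap.toMatrix_apply]
  have hint : ∀ i, Integrable (fun g => (Pi.basisFun ℂ (Fin d)).repr
      (ρ g ((Pi.basisFun ℂ (Fin d)) i)) i) μ := fun i =>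
    (hρ _ ((Pi.basisFun ℂ (Fin d)).coord i)).integrable_of_compactSpace
  rw [integral_finsetSum _ fun i _ => hint i]
  refine Finset.sum_eq_zero fun i _ => ?_
  refine (hB _ ((Pi.basisFun ℂ (Fin d)).coord i)).symm.trans ?_
  simp [hB0]

/-- Convergence of the averages of a continuous function along a sequence to its mean is preserved
under uniform limits. -/
theorem NormalizedRadonMeasure.isClosed_setOf_tendsto_average {X : Type*} [TopologicalSpace X]
    [CompactSpace X] (ν : NormalizedRadonMeasure X) (x : ℕ → X) :
    IsClosed {f : C(X, ℂ) | Tendsto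
      (fun n : ℕ => (1 / (n : ℂ)) * ∑ i ∈ Finset.range n, f (x i)) atTop (𝓝 (ν.toCLM f))} := by
  refine Equicontinuous.isClosed_setOfPred_tendsto
    (F := fun (n : ℕ) (f : C(X, ℂ)) => (1 / (n : ℂ)) * ∑ i ∈ Finset.range n, f (x i)) ?_
    ν.toCLM.continuous
  refine (LipschitzWith.uniformEquicontinuous _ 1 fun n => ?_).equicontinuous
  refine LipschitzWith.of_dist_le_mul fun f g => ?_
  rw [dist_eq_norm, ← mul_sub, ← Finset.sum_sub_distrib, norm_mul, NNReal.coe_one, one_mul]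
  have hsum : ‖∑ i ∈ Finset.range n, (f (x i) - g (x i))‖ ≤ n * dist f g := by
    have hi : ∀ i ∈ Finset.range n, ‖f (x i) - g (x i)‖ ≤ dist f g := fun i _ => by
      rw [← dist_eq_norm]
      exact ContinuousMap.dist_apply_le_dist _
    simpa using norm_sum_le_of_le _ hi
  calc ‖(1 / (n : ℂ))‖ * _ ≤ 1 / (n : ℝ) * (n * dist f g) := by
        gcongr
        simp
    _ ≤ dist f g := by
        rw [← mul_assoc, one_div]
        exact mul_le_of_le_one_left dist_nonneg (inv_mul_le_one)

end Equidistribution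

theorem corollary2p5 {G : Type*} [Group G] [TopologicalSpace G] [IsTopologicalGroup G]
    [CompactSpace G] [T2Space G] [MeasurableSpace G] [BorelSpace G]
    (μ : Measure G) [μ.IsHaarMeasure] [IsProbabilityMeasure μ] (x : ℕ → ConjClasses G) :
    (haarConj μ).IsEquidistributed x ↔
      ∀ χ : ConjClasses G → ℂ, IsIrreducibleCharacter χ → χ ≠ 1 →
        Tendsto (fun n : ℕ => (1 / (n : ℂ)) * ∑ i ∈ Finset.range n, χ (x i)) atTop (𝓝 0) := by
  have hmean : ∀ χ : C(ConjClasses G, ℂ), IsIrreducibleCharacter χ → (χ : ConjClasses G → ℂ) ≠ 1 →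
      (haarConj μ).toCLM χ = 0 := fun χ hχ h1 => hχ.integral_eq_zero μ h1
  constructor
  · intro h χ hχ h1
    have := h ⟨χ, hχ.continuous⟩
    rwa [hmean ⟨χ, hχ.continuous⟩ hχ h1] at this
  · intro h f
    have : CompactSpace (ConjClasses G) := Quotient.compactSpace
    have hf : f ∈ closure (irreducibleCharacterSpan G : Set C(ConjClasses G, ℂ)) := by
      rw [← Submodule.topologicalClosure_coe, topologicalClosure_irreducibleCharacterSpan]
      exact Submodule.mem_top
    refine closure_minimal (fun F hF => ?_)
      ((haarConj μ).isClosed_setOf_tendsto_average x) hf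
    rw [Set.mem_ofPred_eq]
    induction hF using Submodule.span_induction with
    | mem χ hχ =>
      by_cases h1 : (χ : ConjClasses G → ℂ) = 1
      · obtain rfl : χ = 1 := DFunLike.coe_injective h1
        rw [(haarConj μ).map_one]
        -- the average of zero terms is `0`, not `1`
        refine tendsto_const_nhds.congr' ?_
        filter_upwards [eventually_ne_atTop 0] with n hn
        simp [hn]
      · rw [hmean χ hχ h1]
        exact h χ hχ h1
    | zero => simp
    | add F₁ F₂ _ _ h₁ h₂ =>
      simpa [Finset.sum_add_distrib, mul_add] using h₁.add h₂
    | smul c F _ hF =>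
      rw [map_smul, smul_eq_mul]
      refine (hF.const_mul c).congr fun n => ?_
      simp only [ContinuousMap.smul_apply, smul_eq_mul, ← Finset.mul_sum]
      ring
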